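/- Let $G=(V,E)$ be a finite directed graph without self-loops; each edge $e\in E$ has a length $\ell_e>0$ and a velocity $c_e>0$ and is identified with $[0,\ell_e]$, where $x=0$ is its starting vertex and $x=\ell_e$ its end vertex. Let $E(v)$ be the set of edges connected to the vertex $v$ and $c^v_{\mathrm{tot}}=\sum_{e\in E(v)}c_e$. Let $T>0$, $V_C\subseteq V$, let $u^v:[0,T]\to\mathbb R$ ($v\in V_C$) be controls, and put $\bar u^v=-u^v$ for $v\in V_C$ and $\bar u^v=0$ otherwise. Let $y_0^e,y_1^e:[0,\ell_e]\to\mathbb R$ ($e\in E$) be initial data with $y_0^e$ differentiable. For velocities $a_e:[0,T]\to[0,\infty)$, consider the system for $w_\pm^e(t,x)$, $0\le t\le T$, $0\le x\le \ell_e$, $$\partial_t w^e_--a_e(t)\,\partial_x w^e_-=0,\qquad \partial_t w^e_++a_e(t)\,\partial_x w^e_+=0,$$ $$w^e_{\mathrm{in}}(t,v)=-w^e_{\mathrm{out}}(t,v)+\frac{2}{c^v_{\mathrm{tot}}}\Big(\sum_{k\in E(v)}c_k w^k_{\mathrm{out}}(t,v)+\bar u^v(t)\Big)\qquad (v\in V,\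 e\in E(v),\ 0<t\le T),\tag{BC}$$ $$w^e_\mp(0,x)=y_1^e(x)\pm c_e\,\partial_x y_0^e(x).$$ Here $(w^e_{\mathrm{out}},w^e_{\mathrm{in}})(t,v)=(w^e_+,w^e_-)(t,\ell_e)$ if $v$ is the end vertex of $e$, and $(w^e_-,w^e_+)(t,0)$ if $v$ is its starting vertex. Solutions are understood along characteristics: $w^e_+$ is constant along $r\mapsto x-\int_r^t a_e\,d\tau$, followed backwards from $(t,x)$ until it first reaches the entrance $x=0$ or time $0$, and $w^e_-$ is constant along $r\mapsto x+\int_r^t a_e\,d\tau$ until it first reaches the entrance $x=\ell_e$ or time $0$; $w^e_\pm(\cdot,x)$ is integrable on $(0,T)$ for $0<x<\ell_e$. The displacement belonging to a solution is $y^e(t,x)=y^e_0(x)+\int_0^t\frac{w^e_+(s,x)+w^e_-(s,x)}2\,ds$. Let $p_S\ge 0$ ($S\subseteq E$) with $\sum_S p_S=1$ be such that $\pi_e=\sum_{S\ni e}p_S>0$ for every $e\in E$. For a grid $0=t_0<t_1<\dots<t_K=T$ let $h=\max_k(t_k-t_{k-1})$, choose independently for $k=1,\dots,K$ subsets $\omega_k\subseteq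 E$ with $\mathbb P(\omega_k=S)=p_S$, and for $t\in(t_{k-1},t_k]$ let $c_{h,e}(\boldsymbol\omega,t)=c_e/\pi_e$ if $e\in\omega_k$ and $c_{h,e}(\boldsymbol\omega,t)=0$ if $e\notin\omega_k$. Let $w_\pm$, $y$ be the solution of the system with $a_e= c_e$ and its displacement (the original dynamics), and $w_{h\pm}(\boldsymbol\omega)$, $y_h(\boldsymbol\omega)$ those with $a_e=c_{h,e}(\boldsymbol\omega,\cdot)$ (the random-batch dynamics; the coefficients $c_k$, $c^v_{\mathrm{tot}}$ in (BC) are not changed). **Theorem.** Assume that 1) the initial values $w_\pm^e(0,\cdot)$ and $\bar u^v(0)$ satisfy (BC) at $t=0$, 2) $\partial_xy_0^e$ and $y_1^e$ are Lipschitz on $[0,\ell_e]$ for every $e\in E$, and 3) $u^v$ is Lipschitz on $[0,T]$ for every $v\in V_C$. Then there is a constant $C$, independent of the time grid (hence of $h$ and $K$), such that for every time grid, every $e\in E$, $x\in(0,\ell_e)$ and $t\in[0,T]$ $$\mathbb E\big[|w^e_{h-}(t,x)-w^e_-(t,x)|^2+|w^e_{h+}(t,x)-w^e_+(t,x)|^2+|y^e_h(t,x)-y^e(t,x)|^2\big]\le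 C\,h .$$ -/

import Mathlib

open Set

noncomputable section

/-- A directed metric graph (parallel edges allowed, no self-loops) with a propagation velocity
on each edge.  Edge `e` is parametrized by `[0, len e]`, with `0` at the vertex `src e` and
`len e` at the vertex `tgt e`. -/
structure WaveNetwork (V E : Type*) where
  src : E → V
  tgt : E → V
  src_ne_tgt : ∀ e, src e ≠ tgt e
  len : E → ℝ
  len_pos : ∀ e, 0 < len e
  speed : E → ℝ
  speed_pos : ∀ e, 0 < speed e

namespace WaveNetwork

/-- The edges connected to `v`. -/
def edgesAt {V E : Type*} [DecidableEq V] [Fintype E] (N : WaveNetwork V E) (v : V) : Finset E :=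
  Finset.univ.filter fun e => N.src e = v ∨ N.tgt e = v

/-- The sum of the velocities of the edges connected to `v`. -/
def speedTot {V E : Type*} [DecidableEq V] [Fintype E] (N : WaveNetwork V E) (v : V) : ℝ :=
  ∑ e ∈ N.edgesAt v, N.speed e

/-- The incidence matrix. -/
def incidence {V E : Type*} [DecidableEq V] (N : WaveNetwork V E) (v : V) (e : E) : ℝ :=
  if N.src e = v then -1 else if N.tgt e = v then 1 else 0

/-- The coordinate on the edge `e` of its end `v`. -/
def coord {V E : Type*} [DecidableEq V] (N : WaveNetwork V E) (v : V) (e : E) : ℝ :=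
  if N.tgt e = v then N.len e else 0

/-- The value at `v` of the Riemann invariant that leaves the edge `e` at its end `v`: the
right-going one `wp` at the end point of `e`, the left-going one `wm` at its starting point. -/
def wOut {V E : Type*} [DecidableEq V] (N : WaveNetwork V E) (wm wp : E → ℝ → ℝ)
    (v : V) (e : E) : ℝ :=
  if N.tgt e = v then wp e (N.len e) else wm e 0

/-- The value at `v` of the Riemann invariant that enters the edge `e` at its end `v`. -/
def wIn {V E : Type*} [DecidableEq V] (N : WaveNetwork V E) (wm wp : E → ℝ → ℝ)
    (v : V) (e : E) : ℝ :=
  if N.tgt e = v then wm e (N.len e) else wp e 0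

/-- The boundary and transmission conditions at the vertices, at a fixed time, for spatial
profiles `wm`, `wp` and a vertex load `ub`.  Since `wOut` is here the invariant that really is
transported towards the vertex, the load carries a plus sign.  By `vertexCondition_iff_flux` this
is the Kirchhoff condition together with continuity; by `vertexCondition_iff_swap` it is the same
relation as the one with the roles of `wIn` and `wOut` exchanged and a minus sign at the load. -/
def VertexCondition {V E : Type*} [DecidableEq V] [Fintype E] (N : WaveNetwork V E)
    (ub : V → ℝ) (wm wp : E → ℝ → ℝ) : Prop :=
  ∀ v, ∀ e ∈ N.edgesAt v,
    N.wIn wm wp v e = - N.wOut wm wp v e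
      + 2 / N.speedTot v * (∑ k ∈ N.edgesAt v, N.speed k * N.wOut wm wp v k + ub v)

theorem speedTot_pos {V E : Type*} [DecidableEq V] [Fintype E] (N : WaveNetwork V E) {v : V}
    {e : E} (he : e ∈ N.edgesAt v) : 0 < N.speedTot v :=
  Finset.sum_pos (fun k _ => N.speed_pos k) ⟨e, he⟩

theorem vertexCondition_iff_swap {V E : Type*} [DecidableEq V] [Fintype E] (N : WaveNetwork V E)
    (ub : V → ℝ) (wm wp : E → ℝ → ℝ) :
    N.VertexCondition ub wm wp ↔ ∀ v, ∀ e ∈ N.edgesAt v,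
      N.wOut wm wp v e = - N.wIn wm wp v e
        + 2 / N.speedTot v * (∑ k ∈ N.edgesAt v, N.speed k * N.wIn wm wp v k - ub v) := by
  refine forall_congr' fun v => ?_
  have key : ∀ (f g : E → ℝ) (b : ℝ),
      (∀ e ∈ N.edgesAt v, f e = - g e
        + 2 / N.speedTot v * (∑ k ∈ N.edgesAt v, N.speed k * g k + b)) →
      ∀ e ∈ N.edgesAt v, g e = - f e
        + 2 / N.speedTot v * (∑ k ∈ N.edgesAt v, N.speed k * f k - b) := by
    intro f g b h e he
    have hpos := N.speedTot_pos he
    set A := ∑ k ∈ N.edgesAt v, N.speed k * g k with hA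
    have hsum : ∑ k ∈ N.edgesAt v, N.speed k * f k
        = - A + N.speedTot v * (2 / N.speedTot v * (A + b)) := by
      rw [hA, ← Finset.sum_neg_distrib, speedTot, Finset.sum_mul, ← Finset.sum_add_distrib]
      refine Finset.sum_congr rfl fun k hk => ?_
      rw [h k hk, ← speedTot]
      ring
    rw [hsum, h e he]
    field_simp
    ring
  constructor
  · exact key _ _ _
  · intro h
    have h' := key (N.wOut wm wp v) (N.wIn wm wp v) (- ub v)
      (by simpa only [sub_eq_add_neg] using h)
    simpa only [sub_neg_eq_add] using h'

theorem vertexCondition_iff_flux {V E : Type*} [DecidableEq V] [Fintype E] (N : WaveNetwork V E)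
    (ub : V → ℝ) (wm wp : E → ℝ → ℝ) :
    N.VertexCondition ub wm wp ↔ ∀ v, (N.edgesAt v).Nonempty →
      (∑ e ∈ N.edgesAt v, N.speed e * N.incidence v e
          * ((wm e (N.coord v e) - wp e (N.coord v e)) / 2) = ub v) ∧
      ∀ e ∈ N.edgesAt v, ∀ k ∈ N.edgesAt v,
        wm e (N.coord v e) + wp e (N.coord v e) = wm k (N.coord v k) + wp k (N.coord v k) := by
  have hsum : ∀ v, ∀ e, wm e (N.coord v e) + wp e (N.coord v e)
      = N.wIn wm wp v e + N.wOut wm wp v e := by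
    intro v e
    unfold coord wIn wOut
    split_ifs <;> ring
  have hdiff : ∀ v, ∀ e ∈ N.edgesAt v, N.incidence v e
      * ((wm e (N.coord v e) - wp e (N.coord v e)) / 2)
      = (N.wIn wm wp v e - N.wOut wm wp v e) / 2 := by
    intro v e he
    have hne := N.src_ne_tgt e
    simp only [edgesAt, Finset.mem_filter, Finset.mem_univ, true_and] at he
    unfold coord wIn wOut incidence
    rcases he with he | he
    · have h2 : N.tgt e ≠ v := fun h => hne (he.trans h.symm)
      simp only [he, h2, if_true, if_false]
      ring
    · have h2 : N.src e ≠ v := fun h => hne (h.trans he.symm)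
      simp only [he, h2, if_true, if_false]
      ring
  refine forall_congr' fun v => ?_
  have hfl : ∑ e ∈ N.edgesAt v, N.speed e * N.incidence v e
          * ((wm e (N.coord v e) - wp e (N.coord v e)) / 2)
      = ∑ e ∈ N.edgesAt v, N.speed e * ((N.wIn wm wp v e - N.wOut wm wp v e) / 2) :=
    Finset.sum_congr rfl fun e he => by rw [mul_assoc, hdiff v e he]
  rw [hfl]
  simp only [hsum]
  constructor
  · rintro h ⟨e₀, he₀⟩
    have hpos := N.speedTot_pos he₀
    refine ⟨?_, fun e he k hk => by rw [h e he, h k hk]; ring⟩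
    set A := ∑ k ∈ N.edgesAt v, N.speed k * N.wOut wm wp v k with hA
    have : ∑ e ∈ N.edgesAt v, N.speed e * ((N.wIn wm wp v e - N.wOut wm wp v e) / 2)
        = - A + N.speedTot v * (1 / N.speedTot v * (A + ub v)) := by
      rw [hA, ← Finset.sum_neg_distrib, speedTot, Finset.sum_mul, ← Finset.sum_add_distrib]
      refine Finset.sum_congr rfl fun k hk => ?_
      rw [h k hk, ← speedTot]
      ring
    rw [this]
    field_simp
    ring
  · intro h e he
    obtain ⟨h1, h2⟩ := h ⟨e, he⟩
    have hpos := N.speedTot_pos he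
    set A := ∑ k ∈ N.edgesAt v, N.speed k * N.wOut wm wp v k with hA
    have : ∑ k ∈ N.edgesAt v, N.speed k * ((N.wIn wm wp v k - N.wOut wm wp v k) / 2)
        = - A + N.speedTot v * ((N.wIn wm wp v e + N.wOut wm wp v e) / 2) := by
      rw [hA, ← Finset.sum_neg_distrib, speedTot, Finset.sum_mul, ← Finset.sum_add_distrib]
      refine Finset.sum_congr rfl fun k hk => ?_
      rw [h2 e he k hk]
      ring
    rw [this] at h1
    rw [← h1]
    field_simp
    ring

/-- The initial value `y₁ + c y₀'` of the left-going Riemann invariant. -/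
def initMinus {V E : Type*} (N : WaveNetwork V E) (y₀ y₁ : E → ℝ → ℝ) (e : E) (x : ℝ) : ℝ :=
  y₁ e x + N.speed e * derivWithin (y₀ e) (Icc 0 (N.len e)) x

/-- The initial value `y₁ - c y₀'` of the right-going Riemann invariant. -/
def initPlus {V E : Type*} (N : WaveNetwork V E) (y₀ y₁ : E → ℝ → ℝ) (e : E) (x : ℝ) : ℝ :=
  y₁ e x - N.speed e * derivWithin (y₀ e) (Icc 0 (N.len e)) x

/-- `wm e t x`, `wp e t x` solve, on `0 ≤ t ≤ T`, the transport equations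
`∂ₜ wm - a ∂ₓ wm = 0`, `∂ₜ wp + a ∂ₓ wp = 0` on each edge, with a nonnegative velocity
`a e t`, in the sense of characteristics, with the vertex conditions and the initial values coming
from `y₀`, `y₁`.

The characteristic of `wp` through `(t, x)` is `r ↦ x - ∫ r..t, a`, and `wp` is constant along
it for as long as, going back in time, it has not reached the entrance `0` of the edge; the value
found at the entrance is the one given by the vertex condition.  Symmetrically for `wm`, whose
entrance is `len e`.  An edge whose velocity vanishes keeps its profile, including the value at its
exit, while the value at its entrance still obeys the vertex condition but does not propagate.

The velocities in the vertex conditions are those of the network, not `a`. -/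
structure IsSolution {V E : Type*} [DecidableEq V] [Fintype E] (N : WaveNetwork V E) (T : ℝ)
    (a : E → ℝ → ℝ) (ub : V → ℝ → ℝ) (y₀ y₁ : E → ℝ → ℝ) (wm wp : E → ℝ → ℝ → ℝ) : Prop where
  initial_minus : ∀ e, ∀ x ∈ Icc 0 (N.len e), wm e 0 x = N.initMinus y₀ y₁ e x
  initial_plus : ∀ e, ∀ x ∈ Icc 0 (N.len e), wp e 0 x = N.initPlus y₀ y₁ e x
  transport_minus : ∀ e, ∀ s t x : ℝ, 0 ≤ s → s ≤ t → t ≤ T → x ∈ Icc 0 (N.len e) →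
    (∀ r ∈ Ioc s t, x + (∫ τ in r..t, a e τ) < N.len e) →
    wm e t x = wm e s (x + ∫ τ in s..t, a e τ)
  transport_plus : ∀ e, ∀ s t x : ℝ, 0 ≤ s → s ≤ t → t ≤ T → x ∈ Icc 0 (N.len e) →
    (∀ r ∈ Ioc s t, 0 < x - (∫ τ in r..t, a e τ)) →
    wp e t x = wp e s (x - ∫ τ in s..t, a e τ)
  vertex : ∀ t ∈ Ioc 0 T,
    N.VertexCondition (fun v => ub v t) (fun e => wm e t) (fun e => wp e t)
  integrable_minus : ∀ e, ∀ x ∈ Ioo 0 (N.len e),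
    IntervalIntegrable (fun t => wm e t x) MeasureTheory.volume 0 T
  integrable_plus : ∀ e, ∀ x ∈ Ioo 0 (N.len e),
    IntervalIntegrable (fun t => wp e t x) MeasureTheory.volume 0 T

end WaveNetwork

/-- The displacement recovered from the Riemann invariants by `2 ∂ₜ y = wp + wm`. -/
def displacement {E : Type*} (y₀ : E → ℝ → ℝ) (wm wp : E → ℝ → ℝ → ℝ) (e : E) (t x : ℝ) : ℝ :=
  y₀ e x + ∫ s in (0 : ℝ)..t, (wp e s x + wm e s x) / 2

/-- The load: minus the control at the controlled vertices, zero at the others. -/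
def vertexLoad {V : Type*} [DecidableEq V] (VC : Finset V) (u : V → ℝ → ℝ) (v : V) (t : ℝ) : ℝ :=
  if v ∈ VC then - u v t else 0

/-- A subdivision `0 = t₀ < t₁ < ⋯ < t_K = T`. -/
structure TimeGrid (T : ℝ) where
  K : ℕ
  pt : Fin (K + 1) → ℝ
  strictMono : StrictMono pt
  pt_zero : pt 0 = 0
  pt_last : pt (Fin.last K) = T

/-- The largest length of the subintervals. -/
def TimeGrid.mesh {T : ℝ} (G : TimeGrid T) : ℝ :=
  ⨆ k : Fin G.K, (G.pt k.succ - G.pt k.castSucc)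

/-- The probability that the edge `e` is selected, if the subset `S` of the edges is selected with
probability `p S`. -/
def inclusionProb {E : Type*} [Fintype E] [DecidableEq E] (p : Finset E → ℝ) (e : E) : ℝ :=
  ∑ S : Finset E, if e ∈ S then p S else 0

/-- The randomized velocity on `e`: on the `k`-th subinterval `(t_{k-1}, t_k]` it is `c / π` if
`e` belongs to the subset `ω k` selected there, and zero otherwise. -/
def randomSpeed {V E : Type*} [Fintype E] [DecidableEq E] (N : WaveNetwork V E)
    (p : Finset E → ℝ) {T : ℝ} (G : TimeGrid T) (ω : Fin G.K → Finset E) (e : E) (t : ℝ) : ℝ :=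
  ∑ k : Fin G.K, (Ioc (G.pt k.castSucc) (G.pt k.succ)).indicator
    (fun _ => if e ∈ ω k then N.speed e / inclusionProb p e else 0) t

/-- Expectation when the `K` subsets are selected independently with probabilities `p`. -/
def batchExpectation {E : Type*} [Fintype E] (p : Finset E → ℝ) (K : ℕ)
    (X : (Fin K → Finset E) → ℝ) : ℝ :=
  ∑ ω : Fin K → Finset E, (∏ k, p (ω k)) * X ω

end

/-! The proof separates a pathwise estimate from a probabilistic one.

Pathwise: follow a characteristic of the perturbed system back from `(t, x)` to its foot, at time
`0` or at the entrance of the edge at some time `s`. The original solution depends on the phase `x -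
c t` only, through a profile that is Lipschitz because the data are Lipschitz and compatible
(`exists_phaseProfile_lipschitz`). Replacing its value at `(t, x)` by its value at the foot
therefore costs at most `Λ * M`, where `M` bounds `|∫ a - c (t - s)|` over all time windows. At time
`0` the two solutions agree. At an entrance, the vertex condition bounds the error by three times
the exit errors at the same instant, since both systems carry the same load. An exit error is again
traced back along a characteristic, and crossing a whole edge takes at least a fixed time `δ`, so
the recursion stops after about `T / δ` rounds. All errors are thus at most `C * M`
(`exists_transport_error_bound`).

Probabilistic: the foot `s` depends on the selections, so `M` has to be uniform in time. At the grid
points the deviation of the integrated random velocity is a sum of independent centred increments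
with variance of order (step)², and between grid points it is affine. Doob's maximal inequality
(`batchExpectation_runningMax_sq_le`) bounds the expected square of `M` by a multiple of `∑ (step)²
≤ T h`. -/

theorem exists_forall_le_of_finite {D : Type*} [Finite D] (f : D → ℝ) :
    ∃ M, 0 ≤ M ∧ ∀ d, f d ≤ M := by
  obtain ⟨M, hM⟩ := Set.finite_range f |>.bddAbove
  exact ⟨max M 0, le_max_right _ _, fun d => (hM ⟨d, rfl⟩).trans (le_max_left _ _)⟩

theorem exists_pos_forall_le_of_finite {D : Type*} [Finite D] (f : D → ℝ) (hf : ∀ d, 0 < f d) :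
    ∃ δ, 0 < δ ∧ ∀ d, δ ≤ f d := by
  obtain ⟨M, hM0, hM⟩ := exists_forall_le_of_finite fun d => (f d)⁻¹
  refine ⟨(M + 1)⁻¹, by positivity, fun d => ?_⟩
  rw [inv_le_comm₀ (by positivity) (hf d)]
  linarith [hM d]

/-! ### Transport with constant velocity -/

/-- `W t z` is constant along the characteristics of velocity `a`, followed backwards in time until
they reach the entrance `z = 0` of the edge `[0, ℓ]`. -/
def IsTransported (T ℓ : ℝ) (a : ℝ → ℝ) (W : ℝ → ℝ → ℝ) : Prop :=
  ∀ s t z : ℝ, 0 ≤ s → s ≤ t → t ≤ T → z ∈ Icc 0 ℓ →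
    (∀ r ∈ Ioc s t, 0 < z - ∫ τ in r..t, a τ) → W t z = W s (z - ∫ τ in s..t, a τ)

/-- The profile that is translated with constant velocity `c`: initial values at `z ≥ 0`, values at
the entrance at `z < 0`. -/
noncomputable def phaseProfile (c : ℝ) (W : ℝ → ℝ → ℝ) (z : ℝ) : ℝ :=
  if 0 ≤ z then W 0 z else W (-z / c) 0

/-- The backward characteristic either reaches time `0` at the point `x - c t ≥ 0`, or meets the
entrance earlier, at time `t - x / c`, which is minus the phase divided by `c`. -/
theorem IsTransported.eq_phaseProfile {T ℓ c : ℝ} {W : ℝ → ℝ → ℝ} (hc : 0 < c)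
    (h : IsTransported T ℓ (fun _ => c) W) {t x : ℝ} (ht : t ∈ Icc 0 T) (hx : x ∈ Icc 0 ℓ) :
    W t x = phaseProfile c W (x - c * t) := by
  unfold phaseProfile
  split_ifs with h0
  · have := h 0 t x le_rfl ht.1 ht.2 hx (fun r hr => by
      simp only [intervalIntegral.integral_const, smul_eq_mul]
      nlinarith [mul_pos hc hr.1])
    rw [this]
    simp only [intervalIntegral.integral_const, smul_eq_mul]
    congr 1; ring
  · have hs : t - x / c = -(x - c * t) / c := by field_simp; ring
    have hxc : x / c * c = x := by field_simp
    have := h (t - x / c) t x (by rw [hs]; apply div_nonneg <;> linarith)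
      (by have := div_nonneg hx.1 hc.le; linarith) ht.2 hx (fun r hr => by
      simp only [intervalIntegral.integral_const, smul_eq_mul]
      nlinarith [mul_lt_mul_of_pos_right hr.1 hc])
    rw [this, hs]
    simp only [intervalIntegral.integral_const, smul_eq_mul]
    congr 1
    field_simp; ring

theorem abs_sub_le_of_Icc_glue {φ : ℝ → ℝ} {a b K : ℝ}
    (h1 : ∀ x ∈ Icc a 0, ∀ y ∈ Icc a 0, |φ x - φ y| ≤ K * |x - y|)
    (h2 : ∀ x ∈ Icc 0 b, ∀ y ∈ Icc 0 b, |φ x - φ y| ≤ K * |x - y|)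
    {x y : ℝ} (hx : x ∈ Icc a b) (hy : y ∈ Icc a b) : |φ x - φ y| ≤ K * |x - y| := by
  have key : ∀ x ∈ Icc a b, ∀ y ∈ Icc a b, x ≤ y → |φ x - φ y| ≤ K * |x - y| := by
    intro x hx y hy hxy
    rcases le_total 0 x with hx0 | hx0
    · exact h2 x ⟨hx0, hx.2⟩ y ⟨hx0.trans hxy, hy.2⟩
    rcases le_total y 0 with hy0 | hy0
    · exact h1 x ⟨hx.1, hx0⟩ y ⟨hy.1, hy0⟩
    have e1 := h1 x ⟨hx.1, hx0⟩ 0 ⟨hx.1.trans hx0, le_rfl⟩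
    have e2 := h2 0 ⟨le_rfl, hy0.trans hy.2⟩ y ⟨hy0, hy.2⟩
    have e3 := abs_sub_le (φ x) (φ 0) (φ y)
    rw [abs_of_nonpos (by linarith : x - 0 ≤ 0)] at e1
    rw [abs_of_nonpos (by linarith : 0 - y ≤ 0)] at e2
    rw [abs_of_nonpos (by linarith : x - y ≤ 0)]
    linarith
  rcases le_total x y with hxy | hxy
  · exact key x hx y hy hxy
  · rw [abs_sub_comm, abs_sub_comm x]
    exact key y hy x hx hxy

/-- The initial branch and the entrance branch share the value `W 0 0` at phase `0`, so the two
bounds can be glued. Compatibility of the data is hidden in `h1`, which includes the time `0`. -/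
theorem phaseProfile_lipschitz {ℓ c τ L₀ Λ : ℝ} {W : ℝ → ℝ → ℝ} (hc : 0 < c)
    (hL₀ : 0 ≤ L₀) (hΛ : 0 ≤ Λ)
    (h0 : ∀ x ∈ Icc 0 ℓ, ∀ y ∈ Icc 0 ℓ, |W 0 x - W 0 y| ≤ L₀ * |x - y|)
    (h1 : ∀ s ∈ Icc 0 τ, ∀ t ∈ Icc 0 τ, |W s 0 - W t 0| ≤ Λ * |s - t|)
    {x y : ℝ} (hx : x ∈ Icc (-(c * τ)) ℓ) (hy : y ∈ Icc (-(c * τ)) ℓ) :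
    |phaseProfile c W x - phaseProfile c W y| ≤ (L₀ + Λ / c) * |x - y| := by
  have hneg : ∀ z ≤ 0, phaseProfile c W z = W (-z / c) 0 := by
    intro z hz
    unfold phaseProfile
    split_ifs with h
    · have : z = 0 := le_antisymm hz h
      simp [this]
    · rfl
  have hΛc : 0 ≤ Λ / c := div_nonneg hΛ hc.le
  refine abs_sub_le_of_Icc_glue ?_ ?_ hx hy
  · intro x hx y hy
    have mem : ∀ z ∈ Icc (-(c * τ)) 0, -z / c ∈ Icc 0 τ := fun z hz =>
      ⟨div_nonneg (by linarith [hz.2]) hc.le, by rw [div_le_iff₀ hc]; linarith [hz.1]⟩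
    rw [hneg x hx.2, hneg y hy.2]
    refine (h1 _ (mem x hx) _ (mem y hy)).trans ?_
    have : |-x / c - -y / c| = |x - y| / c := by
      rw [← abs_neg (x - y), ← abs_of_pos hc, ← abs_div, abs_of_pos hc]
      congr 1; ring
    rw [this]
    have e : Λ * (|x - y| / c) = Λ / c * |x - y| := by ring
    rw [e]
    exact mul_le_mul_of_nonneg_right (by linarith) (abs_nonneg _)
  · intro x hx y hy
    simp only [phaseProfile, hx.1, hy.1, if_true]
    exact (h0 x hx y hy).trans (mul_le_mul_of_nonneg_right (by linarith) (abs_nonneg _))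

/-- With constant velocities and Lipschitz data, the translated profiles are Lipschitz, with a
constant that depends on the data only. -/
theorem exists_phaseProfile_lipschitz {D : Type*} [Finite D] {ℓ c : D → ℝ} (hℓ : ∀ d, 0 < ℓ d)
    (hc : ∀ d, 0 < c d) {T L₀ Lu : ℝ} (hT : 0 ≤ T) (hL₀ : 0 ≤ L₀) (hLu : 0 ≤ Lu) :
    ∃ Λ, 0 ≤ Λ ∧ ∀ W : D → ℝ → ℝ → ℝ, (∀ d, IsTransported T (ℓ d) (fun _ => c d) (W d)) →
      (∀ d, ∀ x ∈ Icc 0 (ℓ d), ∀ y ∈ Icc 0 (ℓ d), |W d 0 x - W d 0 y| ≤ L₀ * |x - y|) →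
      (∀ s ∈ Icc 0 T, ∀ t ∈ Icc 0 T, ∀ B, (∀ d, |W d s (ℓ d) - W d t (ℓ d)| ≤ B) →
        ∀ d, |W d s 0 - W d t 0| ≤ 3 * B + Lu * |s - t|) →
      ∀ d, ∀ x ∈ Icc (-(c d * T)) (ℓ d), ∀ y ∈ Icc (-(c d * T)) (ℓ d),
        |phaseProfile (c d) (W d) x - phaseProfile (c d) (W d) y| ≤ Λ * |x - y| := by
  -- `δ` is the shortest crossing time. The Lipschitz bound for the entrance traces is propagated
  -- from one time window of length `δ` to the next.
  obtain ⟨δ, hδ, hδℓ⟩ := exists_pos_forall_le_of_finite (fun d => ℓ d / c d)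
    fun d => div_pos (hℓ d) (hc d)
  obtain ⟨cM, hcM0, hcM⟩ := exists_forall_le_of_finite c
  obtain ⟨cm, hcm0, hcm⟩ := exists_pos_forall_le_of_finite c hc
  have key : ∀ n : ℕ, ∃ Λ, 0 ≤ Λ ∧ ∀ W : D → ℝ → ℝ → ℝ,
      (∀ d, IsTransported T (ℓ d) (fun _ => c d) (W d)) →
      (∀ d, ∀ x ∈ Icc 0 (ℓ d), ∀ y ∈ Icc 0 (ℓ d), |W d 0 x - W d 0 y| ≤ L₀ * |x - y|) →
      (∀ s ∈ Icc 0 T, ∀ t ∈ Icc 0 T, ∀ B, (∀ d, |W d s (ℓ d) - W d t (ℓ d)| ≤ B) →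
        ∀ d, |W d s 0 - W d t 0| ≤ 3 * B + Lu * |s - t|) →
      ∀ d, ∀ s ∈ Icc 0 (min T (n * δ)), ∀ t ∈ Icc 0 (min T (n * δ)),
        |W d s 0 - W d t 0| ≤ Λ * |s - t| := by
    intro n
    induction n with
    | zero =>
      refine ⟨0, le_rfl, fun W _ _ _ d s hs t ht => ?_⟩
      simp only [CharP.cast_eq_zero, zero_mul, min_eq_right hT, Icc_self, mem_singleton_iff] at hs ht
      simp [hs, ht]
    | succ n ih =>
      obtain ⟨Λ, hΛ, H⟩ := ih
      -- The phase at the exit moves with speed `c d`, so the Lipschitz constant `L₀ + Λ / c d` in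
      -- phase becomes `L₀ * c d + Λ` in time. The vertex coupling then contributes the factor `3`
      -- and the load `Lu`.
      refine ⟨3 * (L₀ * cM + Λ) + Lu, by positivity, fun W h1 h2 h3 d s hs t ht => ?_⟩
      have hH := H W h1 h2 h3
      have hsT : s ∈ Icc 0 T := ⟨hs.1, hs.2.trans (min_le_left _ _)⟩
      have htT : t ∈ Icc 0 T := ⟨ht.1, ht.2.trans (min_le_left _ _)⟩
      have := h3 s hsT t htT ((L₀ * cM + Λ) * |s - t|) (fun d => ?_) d
      · linarith
      have hcδ : c d * δ ≤ ℓ d := by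
        have := hδℓ d
        rw [le_div_iff₀ (hc d)] at this
        linarith
      have hℓmem : ℓ d ∈ Icc 0 (ℓ d) := ⟨(hℓ d).le, le_rfl⟩
      rw [(h1 d).eq_phaseProfile (hc d) hsT hℓmem, (h1 d).eq_phaseProfile (hc d) htT hℓmem]
      -- What leaves by time `(n + 1) * δ` entered by time `n * δ` or was there initially, so the
      -- induction hypothesis covers the whole phase range.
      have mem : ∀ r ∈ Icc 0 (min T ((n + 1 : ℕ) * δ)),
          ℓ d - c d * r ∈ Icc (-(c d * min T (n * δ))) (ℓ d) := by
        intro r hr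
        refine ⟨?_, by nlinarith [hr.1, hc d]⟩
        rcases min_choice T (n * δ) with h | h <;> rw [h]
        · nlinarith [hr.2.trans (min_le_left _ _), hc d, hℓ d]
        · have := hr.2.trans (min_le_right _ _)
          push_cast at this
          nlinarith [hc d]
      refine (phaseProfile_lipschitz (hc d) hL₀ hΛ (h2 d) (hH d) (mem s hs) (mem t ht)).trans ?_
      have : |ℓ d - c d * s - (ℓ d - c d * t)| = c d * |s - t| := by
        rw [← abs_of_pos (hc d), ← abs_mul, abs_of_pos (hc d), ← abs_neg]
        congr 1; ring
      rw [this, ← mul_assoc]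
      refine mul_le_mul_of_nonneg_right ?_ (abs_nonneg _)
      rw [add_mul, div_mul_cancel₀ _ (hc d).ne']
      have := mul_le_mul_of_nonneg_left (hcM d) hL₀
      linarith
  obtain ⟨n, hn⟩ := exists_nat_gt (T / δ)
  rw [div_lt_iff₀ hδ] at hn
  obtain ⟨Λ, hΛ, H⟩ := key n
  refine ⟨L₀ + Λ / cm, by positivity, fun W h1 h2 h3 d x hx y hy => ?_⟩
  have hH := H W h1 h2 h3 d
  rw [min_eq_left hn.le] at hH
  refine (phaseProfile_lipschitz (hc d) hL₀ hΛ (h2 d) hH hx hy).trans ?_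
  refine mul_le_mul_of_nonneg_right ?_ (abs_nonneg _)
  have := div_le_div_of_nonneg_left hΛ hcm0 (hcm d)
  linarith

/-! ### Comparison of two velocities along characteristics -/

/-- Following a backward characteristic from `x` at time `t` until the entrance or time `0`. -/
theorem exists_characteristic_start {f : ℝ → ℝ} (hf : Continuous f) {t : ℝ} (ht : 0 ≤ t)
    (hft : 0 ≤ f t) :
    ∃ s ∈ Icc 0 t, 0 ≤ f s ∧ (∀ r ∈ Ioc s t, 0 < f r) ∧ (s = 0 ∨ f s = 0) := by
  by_cases hne : (Icc 0 t ∩ {r | f r ≤ 0}).Nonempty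
  · obtain ⟨s, ⟨hs, hs0⟩, hmax⟩ :=
      (isCompact_Icc.inter_right (isClosed_le hf continuous_const)).exists_isGreatest hne
    have hpos : ∀ r ∈ Ioc s t, 0 < f r := by
      intro r hr
      by_contra! hle
      exact absurd (hmax ⟨⟨hs.1.trans hr.1.le, hr.2⟩, hle⟩) (not_le.mpr hr.1)
    have hzero : f s = 0 := by
      obtain ⟨r, hr, hr0⟩ := intermediate_value_Icc hs.2 hf.continuousOn ⟨hs0, hft⟩
      rcases hr.1.eq_or_lt with h | h
      · rw [h, hr0]
      · exact absurd hr0 (hpos r ⟨h, hr.2⟩).ne'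
    exact ⟨s, hs, hzero.ge, hpos, Or.inr hzero⟩
  · have hpos : ∀ r ∈ Icc 0 t, 0 < f r := by
      intro r hr
      by_contra! hle
      exact hne ⟨r, hr, hle⟩
    exact ⟨0, ⟨le_rfl, ht⟩, (hpos 0 ⟨le_rfl, ht⟩).le, fun r hr => hpos r ⟨hr.1.le, hr.2⟩,
      Or.inl rfl⟩

/-- If the time-integrated velocities differ by at most `M`, the solutions differ by at most a
constant times `M`. -/
theorem exists_transport_error_bound {D : Type*} [Finite D] {ℓ c aM : D → ℝ} (hℓ : ∀ d, 0 < ℓ d)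
    (hc : ∀ d, 0 < c d) (haM : ∀ d, 0 < aM d) {T Λ : ℝ} (hΛ : 0 ≤ Λ) :
    ∃ C, 0 ≤ C ∧ ∀ W W' : D → ℝ → ℝ → ℝ, ∀ a : D → ℝ → ℝ, ∀ M,
      (∀ d, IsTransported T (ℓ d) (fun _ => c d) (W d)) →
      (∀ d, ∀ x ∈ Icc (-(c d * T)) (ℓ d), ∀ y ∈ Icc (-(c d * T)) (ℓ d),
        |phaseProfile (c d) (W d) x - phaseProfile (c d) (W d) y| ≤ Λ * |x - y|) →
      (∀ d, IsTransported T (ℓ d) (a d) (W' d)) →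
      (∀ d, ∀ r t, IntervalIntegrable (a d) MeasureTheory.volume r t) →
      (∀ d τ, 0 ≤ a d τ) → (∀ d τ, a d τ ≤ aM d) →
      (∀ d, ∀ t ∈ Icc 0 T, ∀ r ∈ Icc 0 t, |(∫ τ in r..t, a d τ) - c d * (t - r)| ≤ M) →
      (∀ d, ∀ x ∈ Icc 0 (ℓ d), W' d 0 x = W d 0 x) →
      (∀ t ∈ Icc 0 T, ∀ B, (∀ d, |W' d t (ℓ d) - W d t (ℓ d)| ≤ B) →
        ∀ d, |W' d t 0 - W d t 0| ≤ 3 * B) →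
      ∀ d, ∀ t ∈ Icc 0 T, ∀ x ∈ Icc 0 (ℓ d), |W' d t x - W d t x| ≤ C * M := by
  -- Here the characteristics of the perturbed velocity are followed, so the crossing time is
  -- bounded below by means of its upper bound `aM`.
  obtain ⟨δ, hδ, hδℓ⟩ := exists_pos_forall_le_of_finite (fun d => ℓ d / aM d)
    fun d => div_pos (hℓ d) (haM d)
  obtain ⟨n, hn⟩ := exists_nat_gt (T / δ)
  rw [div_lt_iff₀ hδ] at hn
  obtain ⟨Cs, hCsz, hCs⟩ : ∃ Cs : ℕ → ℝ, Cs 0 = 0 ∧ ∀ k, Cs (k + 1) = Λ + 3 * Cs k :=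
    ⟨fun k => (fun C => Λ + 3 * C)^[k] 0, rfl, fun k => Function.iterate_succ_apply' _ k 0⟩
  have hCs0 : ∀ k, 0 ≤ Cs k := by
    intro k
    induction k with
    | zero => exact hCsz.ge
    | succ k ih => rw [hCs]; positivity
  refine ⟨Cs (n + 1), hCs0 _, fun W W' a M hW hΛW hW' hint ha0 haM' hM hinit hbd => ?_⟩
  -- Only the perturbed characteristic is traced. The original solution is merely evaluated at its
  -- foot, so it does not matter whether the original characteristic ends at time `0` or at the
  -- entrance.
  have step : ∀ d, ∀ t ∈ Icc 0 T, ∀ x ∈ Icc 0 (ℓ d), ∃ s ∈ Icc 0 t,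
      (|W' d t x - W d t x| ≤ Λ * M ∨
        |W' d t x - W d t x| ≤ |W' d s 0 - W d s 0| + Λ * M ∧ x = ∫ τ in s..t, a d τ) := by
    intro d t ht x hx
    have hcont : Continuous fun r => x - ∫ τ in r..t, a d τ := by
      have h1 : Continuous fun r => ∫ τ in t..r, a d τ :=
        intervalIntegral.continuous_primitive (hint d) t
      have h2 : (fun r => x - ∫ τ in r..t, a d τ) = fun r => x + ∫ τ in t..r, a d τ := by
        funext r
        rw [intervalIntegral.integral_symm]; ring
      rw [h2]
      exact continuous_const.add h1
    obtain ⟨s, hs, hs0, hpos, halt⟩ := exists_characteristic_start hcont ht.1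
      (by simpa using hx.1)
    have hA0 : 0 ≤ ∫ τ in s..t, a d τ :=
      intervalIntegral.integral_nonneg hs.2 fun τ _ => ha0 d τ
    have hy : (x - ∫ τ in s..t, a d τ) ∈ Icc 0 (ℓ d) := ⟨hs0, by linarith [hx.2]⟩
    have hsT : s ∈ Icc 0 T := ⟨hs.1, hs.2.trans ht.2⟩
    have e1 := hW' d s t x hs.1 hs.2 ht.2 hx hpos
    have mem : ∀ r ∈ Icc 0 T, ∀ z ∈ Icc 0 (ℓ d), z - c d * r ∈ Icc (-(c d * T)) (ℓ d) := by
      intro r hr z hz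
      constructor <;> nlinarith [hr.1, hr.2, hz.1, hz.2, hc d]
    have e2 : |W d s (x - ∫ τ in s..t, a d τ) - W d t x| ≤ Λ * M := by
      rw [(hW d).eq_phaseProfile (hc d) hsT hy, (hW d).eq_phaseProfile (hc d) ht hx]
      refine (hΛW d _ (mem s hsT _ hy) _ (mem t ht _ hx)).trans ?_
      refine mul_le_mul_of_nonneg_left ?_ hΛ
      refine le_trans (le_of_eq ?_) (hM d t ht s hs)
      rw [← abs_neg]
      congr 1; ring
    refine ⟨s, hs, ?_⟩
    have e3 := abs_sub_le (W' d t x) (W d s (x - ∫ τ in s..t, a d τ)) (W d t x)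
    rcases halt with h | h
    · left
      subst h
      rw [e1, hinit d _ hy] at e3 ⊢
      simpa using e2
    · right
      rw [h] at e1 e2 e3
      rw [e1] at e3 ⊢
      exact ⟨by linarith, by linarith⟩
  have hM0 : ∀ d : D, 0 ≤ T → 0 ≤ M := fun d hT =>
    (abs_nonneg _).trans (hM d T ⟨hT, le_rfl⟩ T ⟨hT, le_rfl⟩)
  have exit : ∀ k : ℕ, ∀ d, ∀ t ∈ Icc 0 T, t ≤ k * δ →
      |W' d t (ℓ d) - W d t (ℓ d)| ≤ Cs k * M := by
    intro k
    induction k with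
    | zero =>
      intro d t ht htk
      have : t = 0 := le_antisymm (by simpa using htk) ht.1
      subst this
      rw [hinit d _ ⟨(hℓ d).le, le_rfl⟩]
      simp [hCsz]
    | succ k ih =>
      intro d t ht htk
      have hM0' := hM0 d (ht.1.trans ht.2)
      have hk := mul_nonneg (hCs0 k) hM0'
      obtain ⟨s, hs, h | ⟨h, hsx⟩⟩ := step d t ht (ℓ d) ⟨(hℓ d).le, le_rfl⟩
      · rw [hCs]; linarith
      · have hle : (∫ τ in s..t, a d τ) ≤ aM d * (t - s) := by
          have := intervalIntegral.integral_mono_on hs.2 (hint d s t)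
            (intervalIntegrable_const (c := aM d)) fun τ _ => haM' d τ
          simpa [mul_comm] using this
        -- The characteristic has crossed the whole edge between `s` and `t`, so `s` lies in the
        -- range of the previous induction step.
        have hδ' : δ ≤ t - s := by
          refine (hδℓ d).trans ?_
          rw [div_le_iff₀ (haM d)]
          linarith
        have hsT : s ∈ Icc 0 T := ⟨hs.1, hs.2.trans ht.2⟩
        have := hbd s hsT (Cs k * M) (fun d' => ih d' s hsT (by push_cast at htk; linarith)) d
        rw [hCs]; linarith
  intro d t ht x hx
  have hM0' := hM0 d (ht.1.trans ht.2)
  have hk := mul_nonneg (hCs0 n) hM0'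
  obtain ⟨s, hs, h | ⟨h, -⟩⟩ := step d t ht x hx
  · rw [hCs]; linarith
  · have hsT : s ∈ Icc 0 T := ⟨hs.1, hs.2.trans ht.2⟩
    have := hbd s hsT (Cs n * M) (fun d' => exit n d' s hsT (hsT.2.trans hn.le)) d
    rw [hCs]; linarith

/-! ### The network as a family of one-way transport problems -/

namespace WaveNetwork

/-- The profile of the invariant that traverses the edge `d.1` forwards (`d.2 = true`) or backwards,
as a function of the distance from its entrance. -/
def dirProfile {V E : Type*} (N : WaveNetwork V E) (wm wp : E → ℝ → ℝ) (d : E × Bool) (z : ℝ) : ℝ :=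
  if d.2 then wp d.1 z else wm d.1 (N.len d.1 - z)

/-- The vertex at which a traversal enters its edge. -/
def entrance {V E : Type*} (N : WaveNetwork V E) (d : E × Bool) : V :=
  if d.2 then N.src d.1 else N.tgt d.1

theorem wOut_eq_dirProfile {V E : Type*} [DecidableEq V] (N : WaveNetwork V E)
    (wm wp : E → ℝ → ℝ) (v : V) (e : E) :
    N.wOut wm wp v e = N.dirProfile wm wp (e, decide (N.tgt e = v)) (N.len e) := by
  by_cases h : N.tgt e = v <;> simp [wOut, dirProfile, h]

/-- The absence of self-loops matters here: `wIn` tests the end vertex first and would pick the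
wrong direction if both ends coincided. -/
theorem wIn_entrance {V E : Type*} [DecidableEq V] (N : WaveNetwork V E)
    (wm wp : E → ℝ → ℝ) (d : E × Bool) :
    N.wIn wm wp (N.entrance d) d.1 = N.dirProfile wm wp d 0 := by
  obtain ⟨e, b⟩ := d
  have := (N.src_ne_tgt e).symm
  cases b <;> simp [wIn, entrance, dirProfile, this]

theorem mem_edgesAt_entrance {V E : Type*} [DecidableEq V] [Fintype E] (N : WaveNetwork V E)
    (d : E × Bool) : d.1 ∈ N.edgesAt (N.entrance d) := by
  obtain ⟨e, b⟩ := d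
  cases b <;> simp [edgesAt, entrance]

/-- The values at the entrances depend on those at the exits and on the loads in a Lipschitz way. -/
theorem VertexCondition.abs_entrance_sub_le {V E : Type*} [DecidableEq V] [Fintype E]
    {N : WaveNetwork V E} {ub ub' : V → ℝ} {wm wp wm' wp' : E → ℝ → ℝ}
    (h : N.VertexCondition ub wm wp) (h' : N.VertexCondition ub' wm' wp') {B : ℝ}
    (hB : ∀ d : E × Bool,
      |N.dirProfile wm wp d (N.len d.1) - N.dirProfile wm' wp' d (N.len d.1)| ≤ B)
    (d : E × Bool) :
    |N.dirProfile wm wp d 0 - N.dirProfile wm' wp' d 0|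
      ≤ 3 * B + 2 / N.speed d.1 * |ub (N.entrance d) - ub' (N.entrance d)| := by
  have hd := N.mem_edgesAt_entrance d
  set v := N.entrance d with hv
  have hpos := N.speedTot_pos hd
  have hle : N.speed d.1 ≤ N.speedTot v :=
    Finset.single_le_sum (f := N.speed) (fun k _ => (N.speed_pos k).le) hd
  have hout : ∀ k, |N.wOut wm wp v k - N.wOut wm' wp' v k| ≤ B := by
    intro k
    rw [wOut_eq_dirProfile, wOut_eq_dirProfile]
    exact hB _
  have hsum : |∑ k ∈ N.edgesAt v, N.speed k * N.wOut wm wp v k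
      - ∑ k ∈ N.edgesAt v, N.speed k * N.wOut wm' wp' v k| ≤ N.speedTot v * B := by
    rw [← Finset.sum_sub_distrib, speedTot, Finset.sum_mul]
    refine (Finset.abs_sum_le_sum_abs _ _).trans (Finset.sum_le_sum fun k _ => ?_)
    rw [← mul_sub, abs_mul, abs_of_pos (N.speed_pos k)]
    exact mul_le_mul_of_nonneg_left (hout k) (N.speed_pos k).le
  rw [← wIn_entrance, ← wIn_entrance, ← hv, h v _ hd, h' v _ hd]
  set A := ∑ k ∈ N.edgesAt v, N.speed k * N.wOut wm wp v k
  set A' := ∑ k ∈ N.edgesAt v, N.speed k * N.wOut wm' wp' v k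
  have e : -N.wOut wm wp v d.1 + 2 / N.speedTot v * (A + ub v)
      - (-N.wOut wm' wp' v d.1 + 2 / N.speedTot v * (A' + ub' v))
      = -(N.wOut wm wp v d.1 - N.wOut wm' wp' v d.1)
        + (2 / N.speedTot v * (A - A') + 2 / N.speedTot v * (ub v - ub' v)) := by ring
  rw [e]
  have h2 : 0 ≤ 2 / N.speedTot v := by positivity
  refine (abs_add_le _ _).trans ?_
  have t1 := abs_add_le (2 / N.speedTot v * (A - A')) (2 / N.speedTot v * (ub v - ub' v))
  rw [abs_mul, abs_mul, abs_of_nonneg h2] at t1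
  have t2 := mul_le_mul_of_nonneg_left hsum h2
  have t3 : 2 / N.speedTot v * (N.speedTot v * B) = 2 * B := by field_simp
  -- Passing from the vertex to the edge gives a coefficient indexed by the finite type `E`; `V` is
  -- not assumed finite.
  have t4 : 2 / N.speedTot v * |ub v - ub' v| ≤ 2 / N.speed d.1 * |ub v - ub' v| :=
    mul_le_mul_of_nonneg_right
      (div_le_div_of_nonneg_left zero_le_two (N.speed_pos _) hle) (abs_nonneg _)
  have t5 := hout d.1
  rw [abs_neg]
  linarith

/-- The reflection `z ↦ len - z` turns the left-going equation into the right-going one, so both are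
instances of one statement indexed by `E × Bool`. -/
theorem IsSolution.isTransported {V E : Type*} [DecidableEq V] [Fintype E] {N : WaveNetwork V E}
    {T : ℝ} {a : E → ℝ → ℝ} {ub : V → ℝ → ℝ} {y₀ y₁ : E → ℝ → ℝ} {wm wp : E → ℝ → ℝ → ℝ}
    (h : N.IsSolution T a ub y₀ y₁ wm wp) (d : E × Bool) :
    IsTransported T (N.len d.1) (a d.1)
      (fun t => N.dirProfile (fun e => wm e t) (fun e => wp e t) d) := by
  obtain ⟨e, b⟩ := d
  intro s t z hs hst ht hz hr
  cases b
  · simp only [dirProfile, Bool.false_eq_true, if_false]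
    rw [h.transport_minus e s t (N.len e - z) hs hst ht ⟨by linarith [hz.2], by linarith [hz.1]⟩
      fun r hr' => by linarith [hr r hr']]
    congr 1; ring
  · simp only [dirProfile, if_true]
    exact h.transport_plus e s t z hs hst ht hz hr

theorem IsSolution.dirProfile_zero {V E : Type*} [DecidableEq V] [Fintype E] {N : WaveNetwork V E}
    {T : ℝ} {a : E → ℝ → ℝ} {ub : V → ℝ → ℝ} {y₀ y₁ : E → ℝ → ℝ} {wm wp : E → ℝ → ℝ → ℝ}
    (h : N.IsSolution T a ub y₀ y₁ wm wp) (d : E × Bool) {z : ℝ} (hz : z ∈ Icc 0 (N.len d.1)) :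
    N.dirProfile (fun e => wm e 0) (fun e => wp e 0) d z
      = N.dirProfile (N.initMinus y₀ y₁) (N.initPlus y₀ y₁) d z := by
  obtain ⟨e, b⟩ := d
  cases b
  · simp only [dirProfile, Bool.false_eq_true, if_false]
    exact h.initial_minus e _ ⟨by linarith [hz.2], by linarith [hz.1]⟩
  · simp only [dirProfile, if_true]
    exact h.initial_plus e z hz

/-- `IsSolution.vertex` leaves out `t = 0`; there the condition is the compatibility of the initial
data. -/
theorem IsSolution.vertexCondition {V E : Type*} [DecidableEq V] [Fintype E] {N : WaveNetwork V E}
    {T : ℝ} {a : E → ℝ → ℝ} {ub : V → ℝ → ℝ} {y₀ y₁ : E → ℝ → ℝ} {wm wp : E → ℝ → ℝ → ℝ}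
    (h : N.IsSolution T a ub y₀ y₁ wm wp)
    (hcompat : N.VertexCondition (fun v => ub v 0) (N.initMinus y₀ y₁) (N.initPlus y₀ y₁))
    {t : ℝ} (ht : t ∈ Icc 0 T) :
    N.VertexCondition (fun v => ub v t) (fun e => wm e t) (fun e => wp e t) := by
  rcases ht.1.eq_or_lt with h0 | h0
  · subst h0
    have hin : ∀ v e, N.wIn (fun e => wm e 0) (fun e => wp e 0) v e
        = N.wIn (N.initMinus y₀ y₁) (N.initPlus y₀ y₁) v e := by
      intro v e
      have := (N.len_pos e).le
      unfold wIn
      split_ifs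
      · exact h.initial_minus e _ ⟨this, le_rfl⟩
      · exact h.initial_plus e _ ⟨le_rfl, this⟩
    have hout : ∀ v e, N.wOut (fun e => wm e 0) (fun e => wp e 0) v e
        = N.wOut (N.initMinus y₀ y₁) (N.initPlus y₀ y₁) v e := by
      intro v e
      have := (N.len_pos e).le
      unfold wOut
      split_ifs
      · exact h.initial_plus e _ ⟨this, le_rfl⟩
      · exact h.initial_minus e _ ⟨le_rfl, this⟩
    intro v e he
    simp only [hin, hout]
    exact hcompat v e he
  · exact h.vertex t ⟨h0, ht.2⟩

theorem exists_initial_lipschitz {V E : Type*} [Finite E] (N : WaveNetwork V E)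
    {y₀ y₁ : E → ℝ → ℝ}
    (hy₀_lip : ∀ e, ∃ L, LipschitzOnWith L (derivWithin (y₀ e) (Icc 0 (N.len e)))
      (Icc 0 (N.len e)))
    (hy₁_lip : ∀ e, ∃ L, LipschitzOnWith L (y₁ e) (Icc 0 (N.len e))) :
    ∃ L, 0 ≤ L ∧ ∀ d : E × Bool, ∀ x ∈ Icc 0 (N.len d.1), ∀ y ∈ Icc 0 (N.len d.1),
      |N.dirProfile (N.initMinus y₀ y₁) (N.initPlus y₀ y₁) d x
        - N.dirProfile (N.initMinus y₀ y₁) (N.initPlus y₀ y₁) d y| ≤ L * |x - y| := by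
  choose L₀ hL₀ using hy₀_lip
  choose L₁ hL₁ using hy₁_lip
  obtain ⟨L, hL0, hL⟩ := exists_forall_le_of_finite fun e => (L₁ e : ℝ) + N.speed e * L₀ e
  refine ⟨L, hL0, ?_⟩
  have hb : ∀ e, ∀ x ∈ Icc 0 (N.len e), ∀ y ∈ Icc 0 (N.len e), ∀ σ : ℝ, |σ| = N.speed e →
      |(y₁ e x + σ * derivWithin (y₀ e) (Icc 0 (N.len e)) x)
        - (y₁ e y + σ * derivWithin (y₀ e) (Icc 0 (N.len e)) y)| ≤ L * |x - y| := by
    intro e x hx y hy σ hσ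
    have e1 := (hL₁ e).dist_le_mul x hx y hy
    have e0 := (hL₀ e).dist_le_mul x hx y hy
    rw [Real.dist_eq, Real.dist_eq] at e0 e1
    have e2 := mul_le_mul_of_nonneg_left e0 (N.speed_pos e).le
    have e3 := mul_le_mul_of_nonneg_right (hL e) (abs_nonneg (x - y))
    rw [add_sub_add_comm, ← mul_sub]
    refine (abs_add_le _ _).trans ?_
    rw [abs_mul, hσ]
    linarith
  rintro ⟨e, b⟩ x hx y hy
  cases b
  · simp only [dirProfile, Bool.false_eq_true, if_false, initMinus]
    refine (hb e (N.len e - x) ⟨by linarith [hx.2], by linarith [hx.1]⟩ (N.len e - y)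
      ⟨by linarith [hy.2], by linarith [hy.1]⟩ _ (abs_of_pos (N.speed_pos e))).trans (le_of_eq ?_)
    rw [sub_sub_sub_cancel_left, abs_sub_comm]
  · have := hb e x hx y hy (-N.speed e) (by rw [abs_neg, abs_of_pos (N.speed_pos e)])
    simpa only [dirProfile, if_true, initPlus, neg_mul, ← sub_eq_add_neg] using this

end WaveNetwork

theorem exists_vertexLoad_lipschitz {V : Type*} [DecidableEq V] {VC : Finset V} {u : V → ℝ → ℝ}
    {T : ℝ} (hu : ∀ v ∈ VC, ∃ L, LipschitzOnWith L (u v) (Icc 0 T)) :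
    ∃ L, 0 ≤ L ∧ ∀ v, ∀ s ∈ Icc 0 T, ∀ t ∈ Icc 0 T,
      |vertexLoad VC u v s - vertexLoad VC u v t| ≤ L * |s - t| := by
  choose! L hL using hu
  obtain ⟨M, hM0, hM⟩ := exists_forall_le_of_finite fun v : VC => (L v : ℝ)
  refine ⟨M, hM0, fun v s hs t ht => ?_⟩
  unfold vertexLoad
  split_ifs with hv
  · have := (hL v hv).dist_le_mul s hs t ht
    rw [Real.dist_eq, Real.dist_eq] at this
    rw [neg_sub_neg, abs_sub_comm]
    exact this.trans (mul_le_mul_of_nonneg_right (hM ⟨v, hv⟩) (abs_nonneg _))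
  · simpa using mul_nonneg hM0 (abs_nonneg _)

/-! ### Expectation over independent selections -/

theorem batchExpectation_add {E : Type*} [Fintype E] (p : Finset E → ℝ) (K : ℕ)
    (X Y : (Fin K → Finset E) → ℝ) :
    batchExpectation p K (fun ω => X ω + Y ω) = batchExpectation p K X + batchExpectation p K Y := by
  simp only [batchExpectation, mul_add, Finset.sum_add_distrib]

theorem batchExpectation_const_mul {E : Type*} [Fintype E] (p : Finset E → ℝ) (K : ℕ) (c : ℝ)
    (X : (Fin K → Finset E) → ℝ) :
    batchExpectation p K (fun ω => c * X ω) = c * batchExpectation p K X := by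
  simp only [batchExpectation, Finset.mul_sum]
  exact Finset.sum_congr rfl fun _ _ => by ring

theorem batchExpectation_sum {E ι : Type*} [Fintype E] (p : Finset E → ℝ) (K : ℕ)
    (s : Finset ι) (X : ι → (Fin K → Finset E) → ℝ) :
    batchExpectation p K (fun ω => ∑ i ∈ s, X i ω) = ∑ i ∈ s, batchExpectation p K (X i) := by
  simp only [batchExpectation, Finset.mul_sum]
  exact Finset.sum_comm

theorem batchExpectation_mono {E : Type*} [Fintype E] {p : Finset E → ℝ} (hp : ∀ S, 0 ≤ p S)
    {K : ℕ} {X Y : (Fin K → Finset E) → ℝ} (h : ∀ ω, X ω ≤ Y ω) :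
    batchExpectation p K X ≤ batchExpectation p K Y :=
  Finset.sum_le_sum fun ω _ =>
    mul_le_mul_of_nonneg_left (h ω) (Finset.prod_nonneg fun _ _ => hp _)

/-- A factor that depends on the selection at `i` only is independent of one that does not depend
on the selection at `i`. -/
theorem batchExpectation_mul_of_update {E : Type*} [Fintype E] {p : Finset E → ℝ}
    (hp : ∑ S, p S = 1) {K : ℕ} (i : Fin K) {F : (Fin K → Finset E) → ℝ}
    (hF : ∀ ω S, F (Function.update ω i S) = F ω) (g : Finset E → ℝ) :
    batchExpectation p K (fun ω => F ω * g (ω i))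
      = batchExpectation p K F * ∑ S, p S * g S := by
  cases K with
  | zero => exact i.elim0
  | succ K =>
    have hF' : ∀ S S' (ω : Fin K → Finset E),
        F (i.insertNth (α := fun _ => Finset E) S ω) = F (i.insertNth S' ω) := by
      intro S S' ω
      rw [← hF (i.insertNth S' ω) S, Fin.update_insertNth]
    -- Fubini: the sum over the selection at `i` becomes the inner one.
    have key : ∀ X : (Fin (K + 1) → Finset E) → ℝ, batchExpectation p (K + 1) X
        = ∑ ω : Fin K → Finset E, ∑ S, (∏ k, p (ω k)) * (p S * X (i.insertNth S ω)) := by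
      intro X
      rw [batchExpectation, ← (Fin.insertNthEquiv (fun _ => Finset E) i).sum_comp,
        Fintype.sum_prod_type_right]
      refine Finset.sum_congr rfl fun ω _ => Finset.sum_congr rfl fun S _ => ?_
      rw [Fin.prod_univ_succAbove _ i]
      simp [Fin.insertNthEquiv]
      ring
    rw [key, key, Finset.sum_mul]
    refine Finset.sum_congr rfl fun ω _ => ?_
    have h1 : ∀ S, F (i.insertNth (α := fun _ => Finset E) S ω) = F (i.insertNth ∅ ω) :=
      fun S => hF' S ∅ ω
    simp only [Fin.insertNth_apply_same, h1]
    rw [← Finset.mul_sum _ _ (∏ k, p (ω k)), ← Finset.mul_sum _ _ (∏ k, p (ω k)),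
      ← Finset.sum_mul, hp, one_mul, mul_assoc]
    congr 1
    rw [Finset.mul_sum]
    exact Finset.sum_congr rfl fun S _ => by ring

/-! ### Doob's maximal inequality -/

/-- Running maximum of a sequence, at least `0`. -/
noncomputable def runningMax (s : ℕ → ℝ) : ℕ → ℝ
  | 0 => 0
  | n + 1 => max (runningMax s n) (s (n + 1))

theorem runningMax_mono (s : ℕ → ℝ) : Monotone (runningMax s) :=
  monotone_nat_of_le_succ fun _ => le_max_left _ _

theorem le_runningMax {s : ℕ → ℝ} (hs : s 0 = 0) {k n : ℕ} (hkn : k ≤ n) :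
    s k ≤ runningMax s n := by
  refine le_trans ?_ (runningMax_mono s hkn)
  cases k with
  | zero => exact hs.le
  | succ k => exact le_max_right _ _

theorem runningMax_congr {s s' : ℕ → ℝ} {n : ℕ} (h : ∀ k ≤ n, s k = s' k) :
    runningMax s n = runningMax s' n := by
  induction n with
  | zero => rfl
  | succ n ih =>
    rw [runningMax, runningMax, ih fun k hk => h k (hk.trans n.le_succ), h _ le_rfl]

/-- The pathwise form of Doob's `L²` maximal inequality. -/
theorem runningMax_sq_le {s : ℕ → ℝ} (hs : s 0 = 0) (n : ℕ) :
    runningMax s n ^ 2 ≤ ∑ i ∈ Finset.range n,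
      (4 * (s (i + 1) - s i) ^ 2 + (8 * s i - 4 * runningMax s i) * (s (i + 1) - s i)) := by
  -- A discrete integration by parts: whenever the maximum increases, it equals the current value of
  -- `s`.
  have h1 : ∀ n, ∑ i ∈ Finset.range n, runningMax s i * (s (i + 1) - s i)
      ≤ runningMax s n * s n - runningMax s n ^ 2 / 2 := by
    intro n
    induction n with
    | zero => simp [runningMax]
    | succ n ih =>
      rw [Finset.sum_range_succ]
      rcases le_total (runningMax s n) (s (n + 1)) with h | h
      · have : runningMax s (n + 1) = s (n + 1) := max_eq_right h
        rw [this]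
        nlinarith [sq_nonneg (runningMax s n - s (n + 1))]
      · have : runningMax s (n + 1) = runningMax s n := max_eq_left h
        rw [this]
        nlinarith
  have h2 : ∀ n, ∑ i ∈ Finset.range n, ((s (i + 1) - s i) ^ 2 + 2 * s i * (s (i + 1) - s i))
      = s n ^ 2 := by
    intro n
    induction n with
    | zero => simp [hs]
    | succ n ih => rw [Finset.sum_range_succ, ih]; ring
  have h3 : ∑ i ∈ Finset.range n,
      (4 * (s (i + 1) - s i) ^ 2 + (8 * s i - 4 * runningMax s i) * (s (i + 1) - s i))
      = 4 * s n ^ 2 - 4 * ∑ i ∈ Finset.range n, runningMax s i * (s (i + 1) - s i) := by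
    rw [← h2, Finset.mul_sum, Finset.mul_sum, ← Finset.sum_sub_distrib]
    exact Finset.sum_congr rfl fun _ _ => by ring
  rw [h3]
  -- With `m` the running maximum, `h1` bounds the right side below by `4 s² - 4 m s + 2 m² = m² +
  -- (m - 2 s)²`.
  nlinarith [h1 n, sq_nonneg (runningMax s n - 2 * s n)]

/-- The sum of the first `n` of the increments `X k (ω k)`. -/
noncomputable def batchPartialSum {E : Type*} {K : ℕ} (X : Fin K → Finset E → ℝ)
    (ω : Fin K → Finset E) (n : ℕ) : ℝ :=
  ∑ k : Fin K, if k.val < n then X k (ω k) else 0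

theorem batchPartialSum_zero {E : Type*} {K : ℕ} (X : Fin K → Finset E → ℝ)
    (ω : Fin K → Finset E) : batchPartialSum X ω 0 = 0 := by
  simp [batchPartialSum]

theorem batchPartialSum_succ {E : Type*} {K : ℕ} (X : Fin K → Finset E → ℝ)
    (ω : Fin K → Finset E) (i : Fin K) :
    batchPartialSum X ω (i + 1) = batchPartialSum X ω i + X i (ω i) := by
  have : X i (ω i) = ∑ k : Fin K, if k = i then X k (ω k) else 0 := by simp
  rw [batchPartialSum, batchPartialSum, this, ← Finset.sum_add_distrib]
  refine Finset.sum_congr rfl fun k _ => ?_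
  rcases lt_trichotomy k i with h | h | h
  · have h' : k.val < i.val := h
    simp [h', h.ne, h'.trans (Nat.lt_succ_self _)]
  · simp [h]
  · have h' : i.val < k.val := h
    simp [h.ne', not_lt.mpr h'.le, not_lt.mpr (Nat.succ_le_of_lt h')]

theorem batchPartialSum_neg {E : Type*} {K : ℕ} (X : Fin K → Finset E → ℝ)
    (ω : Fin K → Finset E) (n : ℕ) :
    batchPartialSum (fun k S => -X k S) ω n = -batchPartialSum X ω n := by
  rw [batchPartialSum, batchPartialSum, ← Finset.sum_neg_distrib]
  exact Finset.sum_congr rfl fun k _ => by split_ifs <;> simp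

theorem batchPartialSum_update {E : Type*} {K : ℕ} (X : Fin K → Finset E → ℝ)
    (ω : Fin K → Finset E) (i : Fin K) (S : Finset E) {n : ℕ} (hn : n ≤ i) :
    batchPartialSum X (Function.update ω i S) n = batchPartialSum X ω n := by
  refine Finset.sum_congr rfl fun k _ => ?_
  split_ifs with h
  · have : k ≠ i := fun h' => by subst h'; omega
    rw [Function.update_of_ne this]
  · rfl

/-- Doob's `L²` maximal inequality for sums of independent centred increments. -/
theorem batchExpectation_runningMax_sq_le {E : Type*} [Fintype E] {p : Finset E → ℝ}
    (hp0 : ∀ S, 0 ≤ p S) (hp : ∑ S, p S = 1) {K : ℕ} {X : Fin K → Finset E → ℝ}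
    (hX : ∀ k, ∑ S, p S * X k S = 0) :
    batchExpectation p K (fun ω => runningMax (batchPartialSum X ω) K ^ 2)
      ≤ 4 * ∑ k, ∑ S, p S * X k S ^ 2 := by
  -- The coefficient of the linear term depends only on selections before `k`, so this term has mean
  -- zero. The factor `1 *` gives the quadratic term the product shape required by
  -- `batchExpectation_mul_of_update`.
  have h1 : ∀ ω : Fin K → Finset E, runningMax (batchPartialSum X ω) K ^ 2 ≤ ∑ k : Fin K,
      (4 * (1 * X k (ω k) ^ 2) + (8 * batchPartialSum X ω k
        - 4 * runningMax (batchPartialSum X ω) k) * X k (ω k)) := by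
    intro ω
    refine (runningMax_sq_le (batchPartialSum_zero X ω) K).trans (le_of_eq ?_)
    rw [Finset.sum_range]
    refine Finset.sum_congr rfl fun k _ => ?_
    rw [batchPartialSum_succ]
    ring
  refine (batchExpectation_mono hp0 h1).trans (le_of_eq ?_)
  rw [batchExpectation_sum, Finset.mul_sum]
  refine Finset.sum_congr rfl fun k _ => ?_
  have hone : batchExpectation p K (fun _ => 1) = 1 := by
    simp only [batchExpectation, mul_one]
    rw [← Fintype.prod_sum fun (_ : Fin K) S => p S]
    simp [hp]
  rw [batchExpectation_add, batchExpectation_const_mul,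
    batchExpectation_mul_of_update hp k (F := fun _ => 1) (fun _ _ => rfl) fun S => X k S ^ 2,
    batchExpectation_mul_of_update hp k (F := fun ω => 8 * batchPartialSum X ω k
        - 4 * runningMax (batchPartialSum X ω) k) ?_ (X k), hX k, hone]
  · ring
  · intro ω S
    rw [batchPartialSum_update X ω k S le_rfl,
      runningMax_congr fun n hn => batchPartialSum_update X ω k S hn]

/-! ### Time grids and the integrated random velocity -/

theorem TimeGrid.step_le_mesh {T : ℝ} (G : TimeGrid T) (k : Fin G.K) :
    G.pt k.succ - G.pt k.castSucc ≤ G.mesh :=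
  le_ciSup (f := fun k : Fin G.K => G.pt k.succ - G.pt k.castSucc) (Set.finite_range _).bddAbove k

theorem TimeGrid.step_pos {T : ℝ} (G : TimeGrid T) (k : Fin G.K) :
    0 < G.pt k.succ - G.pt k.castSucc :=
  sub_pos.mpr (G.strictMono Fin.castSucc_lt_succ)

theorem TimeGrid.sum_step {T : ℝ} (G : TimeGrid T) :
    ∑ k : Fin G.K, (G.pt k.succ - G.pt k.castSucc) = T := by
  have h1 := Fin.sum_univ_succ G.pt
  have h2 := Fin.sum_univ_castSucc G.pt
  rw [G.pt_zero] at h1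
  rw [G.pt_last] at h2
  rw [Finset.sum_sub_distrib]
  linarith

theorem TimeGrid.sum_step_sq_le {T : ℝ} (G : TimeGrid T) :
    ∑ k : Fin G.K, (G.pt k.succ - G.pt k.castSucc) ^ 2 ≤ T * G.mesh := by
  have h : ∑ k : Fin G.K, (G.pt k.succ - G.pt k.castSucc) ^ 2
      ≤ (∑ k : Fin G.K, (G.pt k.succ - G.pt k.castSucc)) * G.mesh := by
    rw [Finset.sum_mul]
    refine Finset.sum_le_sum fun k _ => ?_
    rw [sq]
    exact mul_le_mul_of_nonneg_left (G.step_le_mesh k) (G.step_pos k).le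
  rwa [G.sum_step] at h

section RandomSpeed

variable {V E : Type*} [Fintype E] [DecidableEq E] (N : WaveNetwork V E)
  (p : Finset E → ℝ) {T : ℝ} (G : TimeGrid T) (ω : Fin G.K → Finset E) (e : E)

theorem randomSpeed_of_mem {k : Fin G.K} {t : ℝ} (ht : t ∈ Ioc (G.pt k.castSucc) (G.pt k.succ)) :
    randomSpeed N p G ω e t = if e ∈ ω k then N.speed e / inclusionProb p e else 0 := by
  rw [randomSpeed, Finset.sum_eq_single k, indicator_of_mem ht]
  · intro j _ hjk
    refine indicator_of_notMem (fun hj => ?_) _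
    rcases lt_or_gt_of_ne hjk with h | h
    · have : G.pt j.succ ≤ G.pt k.castSucc := G.strictMono.monotone (Fin.succ_le_castSucc_iff.mpr h)
      linarith [hj.2, ht.1]
    · have : G.pt k.succ ≤ G.pt j.castSucc := G.strictMono.monotone (Fin.succ_le_castSucc_iff.mpr h)
      linarith [hj.1, ht.2]
  · simp

theorem randomSpeed_eq_or (t : ℝ) :
    randomSpeed N p G ω e t = 0 ∨ randomSpeed N p G ω e t = N.speed e / inclusionProb p e := by
  by_cases h : ∃ k : Fin G.K, t ∈ Ioc (G.pt k.castSucc) (G.pt k.succ)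
  · obtain ⟨k, hk⟩ := h
    rw [randomSpeed_of_mem N p G ω e hk]
    split_ifs
    · exact Or.inr rfl
    · exact Or.inl rfl
  · left
    refine Finset.sum_eq_zero fun k _ => indicator_of_notMem (fun hk => h ⟨k, hk⟩) _

theorem intervalIntegrable_randomSpeed (r t : ℝ) :
    IntervalIntegrable (randomSpeed N p G ω e) MeasureTheory.volume r t := by
  refine (MeasureTheory.integrable_finsetSum _ fun k _ => ?_).intervalIntegrable
  exact (MeasureTheory.integrableOn_const measure_Ioc_lt_top.ne).integrable_indicator
    measurableSet_Ioc

/-- The contribution of the `k`-th subinterval to the deviation of the random displacement from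
the averaged one. -/
noncomputable def speedIncrement (k : Fin G.K) (S : Finset E) : ℝ :=
  (G.pt k.succ - G.pt k.castSucc)
    * ((if e ∈ S then N.speed e / inclusionProb p e else 0) - N.speed e)

theorem integral_randomSpeed_step {k : Fin G.K} {t : ℝ}
    (ht : t ∈ Icc (G.pt k.castSucc) (G.pt k.succ)) :
    (∫ τ in (0 : ℝ)..t, randomSpeed N p G ω e τ)
      = (∫ τ in (0 : ℝ)..(G.pt k.castSucc), randomSpeed N p G ω e τ)
        + (t - G.pt k.castSucc) * (if e ∈ ω k then N.speed e / inclusionProb p e else 0) := by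
  rw [← intervalIntegral.integral_add_adjacent_intervals
    (intervalIntegrable_randomSpeed N p G ω e 0 (G.pt k.castSucc))
    (intervalIntegrable_randomSpeed N p G ω e (G.pt k.castSucc) t)]
  congr 1
  rw [← smul_eq_mul, ← intervalIntegral.integral_const]
  refine intervalIntegral.integral_congr_ae (Filter.Eventually.of_forall fun τ hτ => ?_)
  rw [uIoc_of_le ht.1] at hτ
  exact randomSpeed_of_mem N p G ω e ⟨hτ.1, hτ.2.trans ht.2⟩

/-- The deviation is affine on each subinterval and equals a partial sum at each grid point, so its
extremes are attained at grid points. -/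
theorem abs_integral_randomSpeed_sub_le {m : ℝ}
    (hm : ∀ n ≤ G.K, |batchPartialSum (speedIncrement N p G e) ω n| ≤ m)
    {t : ℝ} (ht : t ∈ Icc 0 T) :
    |(∫ τ in (0 : ℝ)..t, randomSpeed N p G ω e τ) - N.speed e * t| ≤ m := by
  have key : ∀ k : Fin (G.K + 1),
      (∫ τ in (0 : ℝ)..(G.pt k), randomSpeed N p G ω e τ) - N.speed e * G.pt k
        = batchPartialSum (speedIncrement N p G e) ω k ∧
      ∀ t ∈ Icc 0 (G.pt k),
        |(∫ τ in (0 : ℝ)..t, randomSpeed N p G ω e τ) - N.speed e * t| ≤ m := by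
    intro k
    induction k using Fin.induction with
    | zero =>
      have h0 := hm 0 (Nat.zero_le _)
      rw [batchPartialSum_zero] at h0
      rw [G.pt_zero]
      refine ⟨by simp [batchPartialSum_zero], fun t ht => ?_⟩
      have : t = 0 := le_antisymm ht.2 ht.1
      subst this
      simpa using h0
    | succ k ih =>
      obtain ⟨ih1, ih2⟩ := ih
      have hstep := G.step_pos k
      have hend := integral_randomSpeed_step N p G ω e (k := k) ⟨(sub_pos.mp hstep).le, le_rfl⟩
      have hsucc : (∫ τ in (0 : ℝ)..(G.pt k.succ), randomSpeed N p G ω e τ)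
          - N.speed e * G.pt k.succ = batchPartialSum (speedIncrement N p G e) ω k.succ := by
        rw [Fin.val_succ, batchPartialSum_succ, ← Fin.val_castSucc, ← ih1, hend, speedIncrement]
        ring
      refine ⟨hsucc, fun t ht => ?_⟩
      rcases le_total t (G.pt k.castSucc) with h | h
      · exact ih2 t ⟨ht.1, h⟩
      have h1 := hm k.castSucc (Nat.lt_succ_iff.mp k.castSucc.isLt)
      have h2 := hm k.succ (Nat.lt_succ_iff.mp k.succ.isLt)
      rw [← ih1] at h1
      rw [← hsucc, hend] at h2
      rw [integral_randomSpeed_step N p G ω e (k := k) ⟨h, ht.2⟩]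
      have hts := ht.2
      generalize (if e ∈ ω k then N.speed e / inclusionProb p e else 0) = g at *
      rw [abs_le] at h1 h2 ⊢
      rcases le_total g (N.speed e) with hg | hg
      · constructor <;> nlinarith [h1.1, h1.2, h2.1, h2.2]
      · constructor <;> nlinarith [h1.1, h1.2, h2.1, h2.2]
  have := (key (Fin.last G.K)).2
  rw [G.pt_last] at this
  exact this t ht

end RandomSpeed

/-! ### Mean square of the maximal deviation -/

section Deviation

variable {V E : Type*} [Fintype E] [DecidableEq E] (N : WaveNetwork V E)

/-- The sum over the edges of the squared one-sided maximal deviations of the random displacement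
from the averaged one. -/
noncomputable def sqDeviation (p : Finset E → ℝ) {T : ℝ} (G : TimeGrid T)
    (ω : Fin G.K → Finset E) : ℝ :=
  ∑ e, (runningMax (batchPartialSum (speedIncrement N p G e) ω) G.K ^ 2
    + runningMax (batchPartialSum (fun k S => -speedIncrement N p G e k S) ω) G.K ^ 2)

theorem sqDeviation_nonneg (p : Finset E → ℝ) {T : ℝ} (G : TimeGrid T)
    (ω : Fin G.K → Finset E) : 0 ≤ sqDeviation N p G ω :=
  Finset.sum_nonneg fun _ _ => by positivity

/-- A window `[r, t]` is the difference of two windows starting at `0`, hence the factor `2`.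
`runningMax` is one-sided, so the absolute value needs the increments with both signs; summing over
the edges gives one bound for the whole coupled network. -/
theorem abs_integral_randomSpeed_le_sqDeviation (p : Finset E → ℝ) {T : ℝ} (G : TimeGrid T)
    (ω : Fin G.K → Finset E) (e : E) {t r : ℝ} (ht : t ∈ Icc 0 T) (hr : r ∈ Icc 0 t) :
    |(∫ τ in r..t, randomSpeed N p G ω e τ) - N.speed e * (t - r)|
      ≤ 2 * Real.sqrt (sqDeviation N p G ω) := by
  have hle := Finset.single_le_sum (s := Finset.univ)
    (f := fun e => runningMax (batchPartialSum (speedIncrement N p G e) ω) G.K ^ 2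
      + runningMax (batchPartialSum (fun k S => -speedIncrement N p G e k S) ω) G.K ^ 2)
    (fun _ _ => by positivity) (Finset.mem_univ e)
  have hm : ∀ n ≤ G.K, |batchPartialSum (speedIncrement N p G e) ω n|
      ≤ Real.sqrt (sqDeviation N p G ω) := by
    intro n hn
    have h1 := le_runningMax (batchPartialSum_zero (speedIncrement N p G e) ω) hn
    have h2 := le_runningMax
      (batchPartialSum_zero (fun k S => -speedIncrement N p G e k S) ω) hn
    rw [batchPartialSum_neg (speedIncrement N p G e)] at h2
    refine abs_le'.mpr ⟨h1.trans ?_, h2.trans ?_⟩ <;> refine Real.le_sqrt_of_sq_le (le_trans ?_ hle)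
    · exact le_add_of_nonneg_right (sq_nonneg _)
    · exact le_add_of_nonneg_left (sq_nonneg _)
  have e1 := abs_integral_randomSpeed_sub_le N p G ω e hm ht
  have e2 := abs_integral_randomSpeed_sub_le N p G ω e hm (t := r) ⟨hr.1, hr.2.trans ht.2⟩
  rw [← intervalIntegral.integral_interval_sub_left
    (intervalIntegrable_randomSpeed N p G ω e 0 t) (intervalIntegrable_randomSpeed N p G ω e 0 r)]
  have e3 := abs_sub ((∫ τ in (0 : ℝ)..t, randomSpeed N p G ω e τ) - N.speed e * t)
    ((∫ τ in (0 : ℝ)..r, randomSpeed N p G ω e τ) - N.speed e * r)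
  refine le_trans (le_of_eq ?_) (e3.trans (by linarith))
  congr 1; ring

theorem exists_batchExpectation_sqDeviation_le {p : Finset E → ℝ} (hp_nonneg : ∀ S, 0 ≤ p S)
    (hp_sum : ∑ S : Finset E, p S = 1) (hp_incl : ∀ e, 0 < inclusionProb p e) {T : ℝ} :
    ∃ C, ∀ G : TimeGrid T, batchExpectation p G.K (sqDeviation N p G) ≤ C * G.mesh := by
  let σ : E → ℝ := fun e => ∑ S, p S *
    ((if e ∈ S then N.speed e / inclusionProb p e else 0) - N.speed e) ^ 2
  have hσ : ∀ e, 0 ≤ σ e := fun e =>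
    Finset.sum_nonneg fun S _ => mul_nonneg (hp_nonneg S) (sq_nonneg _)
  -- `8` is Doob's constant `4`, once for each of the two signs.
  refine ⟨∑ e, 8 * (T * σ e), fun G => ?_⟩
  have hmean : ∀ e k, ∑ S, p S * speedIncrement N p G e k S = 0 := by
    intro e k
    -- Division by the inclusion probability makes the random velocity unbiased.
    have h1 : ∑ S : Finset E, p S * (if e ∈ S then N.speed e / inclusionProb p e else 0)
        = N.speed e := by
      have : ∀ S, p S * (if e ∈ S then N.speed e / inclusionProb p e else 0)
          = (if e ∈ S then p S else 0) * (N.speed e / inclusionProb p e) := by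
        intro S; split_ifs <;> simp
      simp only [this]
      rw [← Finset.sum_mul]
      exact mul_div_cancel₀ _ (hp_incl e).ne'
    have h2 : ∀ S, p S * speedIncrement N p G e k S = (G.pt k.succ - G.pt k.castSucc)
        * (p S * (if e ∈ S then N.speed e / inclusionProb p e else 0) - p S * N.speed e) := by
      intro S; rw [speedIncrement]; ring
    simp only [h2]
    rw [← Finset.mul_sum, Finset.sum_sub_distrib, h1, ← Finset.sum_mul, hp_sum]
    ring
  have hvar : ∀ e, ∑ k, ∑ S, p S * speedIncrement N p G e k S ^ 2 ≤ T * σ e * G.mesh := by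
    intro e
    have h1 : ∀ k, ∑ S, p S * speedIncrement N p G e k S ^ 2
        = (G.pt k.succ - G.pt k.castSucc) ^ 2 * σ e := by
      intro k
      rw [Finset.mul_sum]
      refine Finset.sum_congr rfl fun S _ => ?_
      rw [speedIncrement]; ring
    simp only [h1]
    rw [← Finset.sum_mul]
    have := mul_le_mul_of_nonneg_right G.sum_step_sq_le (hσ e)
    linarith
  have hsum : batchExpectation p G.K (sqDeviation N p G) = ∑ e,
      (batchExpectation p G.K
          (fun ω => runningMax (batchPartialSum (speedIncrement N p G e) ω) G.K ^ 2)
        + batchExpectation p G.K (fun ω =>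
            runningMax (batchPartialSum (fun k S => -speedIncrement N p G e k S) ω) G.K ^ 2)) := by
    simp only [← batchExpectation_add]
    exact batchExpectation_sum p G.K Finset.univ _
  rw [hsum, Finset.sum_mul]
  refine Finset.sum_le_sum fun e _ => ?_
  have b1 := batchExpectation_runningMax_sq_le hp_nonneg hp_sum (hmean e)
  have b2 := batchExpectation_runningMax_sq_le hp_nonneg hp_sum
    (X := fun k S => -speedIncrement N p G e k S) (fun k => by
      simpa only [mul_neg, Finset.sum_neg_distrib, neg_eq_zero] using hmean e k)
  simp only [neg_sq] at b2
  linarith [hvar e]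

end Deviation

/-! ### From the deviation to the error of the solutions -/

theorem abs_displacement_sub_le {E : Type*} (y₀ : E → ℝ → ℝ) {wm wp wm' wp' : E → ℝ → ℝ → ℝ}
    {e : E} {x t B : ℝ} (ht : 0 ≤ t)
    (hm : IntervalIntegrable (fun s => wm e s x) MeasureTheory.volume 0 t)
    (hp : IntervalIntegrable (fun s => wp e s x) MeasureTheory.volume 0 t)
    (hm' : IntervalIntegrable (fun s => wm' e s x) MeasureTheory.volume 0 t)
    (hp' : IntervalIntegrable (fun s => wp' e s x) MeasureTheory.volume 0 t)
    (hBm : ∀ s ∈ Icc 0 t, |wm' e s x - wm e s x| ≤ B)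
    (hBp : ∀ s ∈ Icc 0 t, |wp' e s x - wp e s x| ≤ B) :
    |displacement y₀ wm' wp' e t x - displacement y₀ wm wp e t x| ≤ B * t := by
  rw [displacement, displacement, add_sub_add_left_eq_sub,
    ← intervalIntegral.integral_sub ((hp'.add hm').div_const 2) ((hp.add hm).div_const 2)]
  have := intervalIntegral.norm_integral_le_of_norm_le_const (a := 0) (b := t) (C := B)
    (f := fun s => (wp' e s x + wm' e s x) / 2 - (wp e s x + wm e s x) / 2) (fun s hs => by
      rw [uIoc_of_le ht] at hs
      have h1 := abs_le.mp (hBm s ⟨hs.1.le, hs.2⟩)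
      have h2 := abs_le.mp (hBp s ⟨hs.1.le, hs.2⟩)
      rw [Real.norm_eq_abs, abs_le]
      constructor <;> linarith [h1.1, h1.2, h2.1, h2.2])
  rwa [Real.norm_eq_abs, sub_zero, abs_of_nonneg ht] at this

/-- The distance between the solution with the averaged velocities and one with perturbed
velocities is controlled by the largest deviation of the time-integrated velocities. -/
theorem WaveNetwork.exists_solution_error_bound {V E : Type*} [DecidableEq V] [Fintype E]
    (N : WaveNetwork V E) {T : ℝ} (hT : 0 < T) {VC : Finset V} {u : V → ℝ → ℝ} {y₀ y₁ : E → ℝ → ℝ}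
    (hcompat : N.VertexCondition (fun v => vertexLoad VC u v 0)
      (N.initMinus y₀ y₁) (N.initPlus y₀ y₁))
    (hy₀_lip : ∀ e, ∃ L, LipschitzOnWith L (derivWithin (y₀ e) (Icc 0 (N.len e)))
      (Icc 0 (N.len e)))
    (hy₁_lip : ∀ e, ∃ L, LipschitzOnWith L (y₁ e) (Icc 0 (N.len e)))
    (hu_lip : ∀ v ∈ VC, ∃ L, LipschitzOnWith L (u v) (Icc 0 T))
    {aM : E → ℝ} (haM : ∀ e, 0 < aM e) :
    ∃ C, 0 ≤ C ∧ ∀ (a : E → ℝ → ℝ) (M : ℝ) (wm wp wm' wp' : E → ℝ → ℝ → ℝ),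
      N.IsSolution T (fun e _ => N.speed e) (vertexLoad VC u) y₀ y₁ wm wp →
      N.IsSolution T a (vertexLoad VC u) y₀ y₁ wm' wp' →
      (∀ e r t, IntervalIntegrable (a e) MeasureTheory.volume r t) →
      (∀ e τ, 0 ≤ a e τ) → (∀ e τ, a e τ ≤ aM e) →
      (∀ e, ∀ t ∈ Icc 0 T, ∀ r ∈ Icc 0 t, |(∫ τ in r..t, a e τ) - N.speed e * (t - r)| ≤ M) →
      ∀ e, ∀ t ∈ Icc 0 T, ∀ x ∈ Icc 0 (N.len e),
        |wm' e t x - wm e t x| ≤ C * M ∧ |wp' e t x - wp e t x| ≤ C * M := by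
  obtain ⟨L₀, hL₀, hinit⟩ := N.exists_initial_lipschitz hy₀_lip hy₁_lip
  obtain ⟨Lv, hLv, hload⟩ := exists_vertexLoad_lipschitz hu_lip
  obtain ⟨q, hq0, hq⟩ := exists_forall_le_of_finite fun e => 2 / N.speed e
  obtain ⟨Λ, hΛ, hphase⟩ := exists_phaseProfile_lipschitz (D := E × Bool)
    (ℓ := fun d => N.len d.1) (c := fun d => N.speed d.1) (fun d => N.len_pos _)
    (fun d => N.speed_pos _) hT.le hL₀ (mul_nonneg hq0 hLv)
  obtain ⟨C, hC, herr⟩ := exists_transport_error_bound (D := E × Bool)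
    (ℓ := fun d => N.len d.1) (c := fun d => N.speed d.1) (aM := fun d => aM d.1) (T := T)
    (fun d => N.len_pos _) (fun d => N.speed_pos _) (fun d => haM _) hΛ
  refine ⟨C, hC, fun a M wm wp wm' wp' h h' hint ha0 ha hM e t ht x hx => ?_⟩
  have hlip := hphase (fun d t => N.dirProfile (fun e => wm e t) (fun e => wp e t) d)
    h.isTransported
    (fun d x hx y hy => by
      rw [h.dirProfile_zero d hx, h.dirProfile_zero d hy]
      exact hinit d x hx y hy)
    -- The vertex conditions of one solution at two times are compared; the change of the load gives
    -- the Lipschitz term.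
    (fun s hs t ht B hB d => by
      refine ((h.vertexCondition hcompat hs).abs_entrance_sub_le
        (h.vertexCondition hcompat ht) hB d).trans (add_le_add le_rfl ?_)
      rw [mul_assoc]
      exact mul_le_mul (hq d.1) (hload _ s hs t ht) (abs_nonneg _) hq0)
  have hbound := herr (fun d t => N.dirProfile (fun e => wm e t) (fun e => wp e t) d)
    (fun d t => N.dirProfile (fun e => wm' e t) (fun e => wp' e t) d) (fun d => a d.1) M
    h.isTransported hlip h'.isTransported (fun d => hint d.1) (fun d => ha0 d.1)
    (fun d => ha d.1) (fun d => hM d.1)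
    (fun d x hx => by rw [h.dirProfile_zero d hx, h'.dirProfile_zero d hx])
    -- Two solutions at the same time carry the same load, so the load term drops out.
    (fun t ht B hB d => by
      have := (h'.vertexCondition hcompat ht).abs_entrance_sub_le
        (h.vertexCondition hcompat ht) hB d
      simpa using this)
  constructor
  · have := hbound (e, false) t ht (N.len e - x) ⟨by linarith [hx.2], by linarith [hx.1]⟩
    simpa [WaveNetwork.dirProfile] using this
  · simpa [WaveNetwork.dirProfile] using hbound (e, true) t ht x hx

theorem theorem1 {V E : Type*} [DecidableEq V] [Fintype E] [DecidableEq E]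
    (N : WaveNetwork V E)
    (p : Finset E → ℝ) (hp_nonneg : ∀ S, 0 ≤ p S) (hp_sum : ∑ S : Finset E, p S = 1)
    (hp_incl : ∀ e, 0 < inclusionProb p e)
    (T : ℝ) (hT : 0 < T)
    (VC : Finset V) (u : V → ℝ → ℝ) (y₀ y₁ : E → ℝ → ℝ)
    (hcompat : N.VertexCondition (fun v => vertexLoad VC u v 0)
      (N.initMinus y₀ y₁) (N.initPlus y₀ y₁))
    (hy₀_diff : ∀ e, DifferentiableOn ℝ (y₀ e) (Icc 0 (N.len e)))
    (hy₀_lip : ∀ e, ∃ L, LipschitzOnWith L (derivWithin (y₀ e) (Icc 0 (N.len e)))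
      (Icc 0 (N.len e)))
    (hy₁_lip : ∀ e, ∃ L, LipschitzOnWith L (y₁ e) (Icc 0 (N.len e)))
    (hu_lip : ∀ v ∈ VC, ∃ L, LipschitzOnWith L (u v) (Icc 0 T)) :
    ∃ C : ℝ, ∀ wm wp : E → ℝ → ℝ → ℝ,
      N.IsSolution T (fun e _ => N.speed e) (vertexLoad VC u) y₀ y₁ wm wp →
      ∀ G : TimeGrid T, ∀ whm whp : (Fin G.K → Finset E) → E → ℝ → ℝ → ℝ,
        (∀ ω, N.IsSolution T (randomSpeed N p G ω) (vertexLoad VC u) y₀ y₁ (whm ω) (whp ω)) →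
        ∀ e, ∀ x ∈ Ioo 0 (N.len e), ∀ t ∈ Icc 0 T,
          batchExpectation p G.K (fun ω =>
            |whm ω e t x - wm e t x| ^ 2 + |whp ω e t x - wp e t x| ^ 2
              + |displacement y₀ (whm ω) (whp ω) e t x - displacement y₀ wm wp e t x| ^ 2)
            ≤ C * G.mesh := by
  obtain ⟨C₁, hC₁, hpath⟩ := N.exists_solution_error_bound hT hcompat hy₀_lip hy₁_lip hu_lip
    (aM := fun e => N.speed e / inclusionProb p e) fun e => div_pos (N.speed_pos e) (hp_incl e)
  obtain ⟨C₂, hdev⟩ := exists_batchExpectation_sqDeviation_le N hp_nonneg hp_sum hp_incl (T := T)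
  -- Each invariant is off by at most `2 * C₁ * √(sqDeviation)` and the displacement by `T` times
  -- that, which gives `1 + 1 + T ^ 2` after squaring.
  refine ⟨(2 + T ^ 2) * (2 * C₁) ^ 2 * C₂, fun wm wp h G whm whp hh e x hx t ht => ?_⟩
  have hpt : ∀ ω, |whm ω e t x - wm e t x| ^ 2 + |whp ω e t x - wp e t x| ^ 2
      + |displacement y₀ (whm ω) (whp ω) e t x - displacement y₀ wm wp e t x| ^ 2
      ≤ (2 + T ^ 2) * (2 * C₁) ^ 2 * sqDeviation N p G ω := by
    intro ω
    have hpos : ∀ e, 0 < N.speed e / inclusionProb p e := fun e =>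
      div_pos (N.speed_pos e) (hp_incl e)
    have hb := hpath (randomSpeed N p G ω) (2 * Real.sqrt (sqDeviation N p G ω)) wm wp
      (whm ω) (whp ω) h (hh ω) (intervalIntegrable_randomSpeed N p G ω)
      (fun e τ => by
        rcases randomSpeed_eq_or N p G ω e τ with h | h <;> rw [h]
        exact (hpos e).le)
      (fun e τ => by
        rcases randomSpeed_eq_or N p G ω e τ with h | h <;> rw [h]
        exact (hpos e).le)
      (fun e t ht r hr => abs_integral_randomSpeed_le_sqDeviation N p G ω e ht hr) e
    have hx' : x ∈ Icc 0 (N.len e) := ⟨hx.1.le, hx.2.le⟩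
    have hsub : uIcc 0 t ⊆ uIcc 0 T := by
      rw [uIcc_of_le ht.1, uIcc_of_le hT.le]
      exact Icc_subset_Icc le_rfl ht.2
    have hy := abs_displacement_sub_le y₀ ht.1 ((h.integrable_minus e x hx).mono_set hsub)
      ((h.integrable_plus e x hx).mono_set hsub) (((hh ω).integrable_minus e x hx).mono_set hsub)
      (((hh ω).integrable_plus e x hx).mono_set hsub)
      (fun s hs => (hb s ⟨hs.1, hs.2.trans ht.2⟩ x hx').1)
      (fun s hs => (hb s ⟨hs.1, hs.2.trans ht.2⟩ x hx').2)
    have hB0 : 0 ≤ C₁ * (2 * Real.sqrt (sqDeviation N p G ω)) := by positivity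
    have h1 := pow_le_pow_left₀ (abs_nonneg _) (hb t ht x hx').1 2
    have h2 := pow_le_pow_left₀ (abs_nonneg _) (hb t ht x hx').2 2
    have h3 := pow_le_pow_left₀ (abs_nonneg _)
      (hy.trans (mul_le_mul_of_nonneg_left ht.2 hB0)) 2
    have hs := Real.sq_sqrt (sqDeviation_nonneg N p G ω)
    have hB : (C₁ * (2 * Real.sqrt (sqDeviation N p G ω))) ^ 2
        = (2 * C₁) ^ 2 * sqDeviation N p G ω := by
      rw [← hs, Real.sqrt_sq (Real.sqrt_nonneg _)]; ring
    rw [mul_pow _ T, hB] at h3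
    rw [hB] at h1 h2
    linarith
  refine (batchExpectation_mono hp_nonneg hpt).trans ?_
  rw [batchExpectation_const_mul, mul_assoc _ C₂]
  exact mul_le_mul_of_nonneg_left (hdev G) (by positivity)
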